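/- Let $n\ge 0$ be an integer and let $\mathscr P_n$ be the space of complex polynomials of degree at most $n$. Let $\mathcal B_n$ be the class of operators $$B[P](z)=\lambda_0P(z)+\lambda_1\Big(\frac{nz}{2}\Big)\frac{P'(z)}{1!}+\lambda_2\Big(\frac{nz}{2}\Big)^2\frac{P''(z)}{2!},$$ where $\lambda_0,\lambda_1,\lambda_2\in\mathbb C$ are such that every zero $z\in\mathbb C$ of $U(z)=\lambda_0+n\lambda_1z+\frac{n(n-1)}{2}\lambda_2z^2$ satisfies $|z|\le|z-n/2|$. Let $B\in\mathcal B_n$, let $\alpha\in\mathbb C$ with $|\alpha|\le 1$, let $R>r\ge k>0$ be real numbers, and put $\sigma(z)=Rz$, $\rho(z)=rz$. Then for every $P\in\mathscr P_n$ and every $z\in\mathbb C$ with $|z|\ge 1$, $$\big|B[P\circ\sigma](z)-\alpha B[P\circ\rho](z)\big|\le\frac{1}{k^n}\,\big|R^n-\alpha r^n\big|\,\big|B[z^n](z)\big|\,\max_{|w|=k}|P(w)|,$$ where $B[z^n]$ denotes $B$ applied to the monomial of degree $n$. The result is best possible: for every such $z$, equality holds for $P(z)=az^n$ with any $a\in\mathbb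 C$, $a\neq0$, and hence the factor $\frac{1}{k^n}|R^n-\alpha r^n||B[z^n](z)|$ cannot be replaced by any smaller one that works for all $P\in\mathscr P_n$. -/

import Mathlib

open Polynomial

noncomputable section

/-- The second-order differential operator
`B[P](z) = l₀ P(z) + l₁ (n z / 2) P'(z) / 1! + l₂ (n z / 2)² P''(z) / 2!`
with parameters `l₀ l₁ l₂`, acting on complex polynomials. -/
def rahmanOperator (n : ℕ) (l₀ l₁ l₂ : ℂ) (P : ℂ[X]) : ℂ[X] :=
  C l₀ * P + C l₁ * (C ((n : ℂ) / 2) * X) * derivative P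
    + C l₂ * (C ((n : ℂ) / 2) * X) ^ 2 * (C (1 / 2 : ℂ) * derivative (derivative P))

/-- The class `𝓑ₙ`: the operators above whose parameters are such that all zeros of
`U(z) = l₀ + n l₁ z + (n (n - 1) / 2) l₂ z²` lie in the half plane `|z| ≤ |z - n / 2|`. -/
def rahmanClass (n : ℕ) : Set (ℂ[X] → ℂ[X]) :=
  {B | ∃ l₀ l₁ l₂ : ℂ,
    (∀ z : ℂ, l₀ + (n : ℂ) * l₁ * z + (n : ℂ) * ((n : ℂ) - 1) / 2 * l₂ * z ^ 2 = 0 →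
      ‖z‖ ≤ ‖z - (n : ℂ) / 2‖) ∧
    B = rahmanOperator n l₀ l₁ l₂}

/-- The dilation `P ∘ σ` with `σ(z) = t z`. -/
def dilate (t : ℝ) (P : ℂ[X]) : ℂ[X] := P.comp (C (t : ℂ) * X)

/-- The maximum of `|P(z)|` over the circle `|z| = k`. -/
def maxModulus (k : ℝ) (P : ℂ[X]) : ℝ :=
  sSup ((fun w : ℂ => ‖P.eval w‖) '' Metric.sphere 0 k)

/-- For `k ≥ 0` the supremum in `maxModulus` is a maximum. -/
theorem isGreatest_maxModulus {k : ℝ} (hk : 0 ≤ k) (P : ℂ[X]) :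
    IsGreatest ((fun w : ℂ => ‖P.eval w‖) '' Metric.sphere 0 k) (maxModulus k P) := by
  have hc : IsCompact ((fun w : ℂ => ‖P.eval w‖) '' Metric.sphere 0 k) :=
    (isCompact_sphere (0 : ℂ) k).image P.continuous.norm
  exact hc.isGreatest_sSup ((NormedSpace.sphere_nonempty.mpr hk).image _)

end

/-! Suppose the bound fails at `z`. Let `L` be the left-hand quantity before taking norms, `D = R^n
- α r^n`, `b = B[z^n](z)` and `c = L / (D b)`, so that `|c| > max|P| / k^n`. The maximum principle
at infinity shows that `G = P - c z^n` has degree `n` and all its zeros in `|w| < k ≤ r`. Moving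
from `rz` to `Rz` increases the distance to each zero, so `|G(rz)| < |G(Rz)|` for `|z| ≥ 1`, and
`H(z) = G(Rz) - α G(rz)` has degree `n` and all its zeros in the open unit disc. By linearity
`B[H](z) = L - c D b = 0`.

This contradicts the key fact that `B[H]` has no zero in `|z| ≥ 1`. Each linear factor of `U` gives
a polar derivative whose pole, depending on `z`, lies outside the open unit disc; for `n ≥ 2` the
composite of the two, evaluated at `z`, is `n(n-1) B[H](z)`. Laguerre's theorem, applied twice,
shows that it is nonzero. -/

/-! ### Sums over points of the unit disc -/

/-- For one `y` the gap is `(1 - |y|²) / |w - y|²`. The points `1 / (w - y)` thus lie in an open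
disc or half-plane, and by convexity so does their mean. -/
theorem sum_recip_quadratic_bound {w : ℂ} (hw : 1 ≤ ‖w‖) (s : Multiset ℂ) (hs : ∀ y ∈ s, ‖y‖ < 1)
    (h0 : s ≠ 0) :
    (‖w‖ ^ 2 - 1) * ‖(s.map fun y => 1 / (w - y)).sum‖ ^ 2
      < s.card * (2 * (w * (s.map fun y => 1 / (w - y)).sum).re - s.card) := by
  have hq : 0 ≤ ‖w‖ ^ 2 - 1 := by nlinarith
  have base : ∀ y : ℂ, ‖y‖ < 1 →
      (‖w‖ ^ 2 - 1) * ‖1 / (w - y)‖ ^ 2 < 2 * (w * (1 / (w - y))).re - 1 := by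
    intro y hy
    have hne : w - y ≠ 0 := by
      intro h
      rw [sub_eq_zero.1 h] at hw
      linarith
    have hpos : 0 < Complex.normSq (w - y) := Complex.normSq_pos.2 hne
    have h1 : (w * (1 / (w - y))).re
        = (w.re * (w.re - y.re) + w.im * (w.im - y.im)) / Complex.normSq (w - y) := by
      rw [mul_one_div, Complex.div_re]
      simp only [Complex.sub_re, Complex.sub_im]
      ring
    rw [h1, norm_div, norm_one, div_pow, one_pow, mul_one_div, Complex.sq_norm (w - y),
      ← sub_pos]
    have h2 : 2 * ((w.re * (w.re - y.re) + w.im * (w.im - y.im)) / Complex.normSq (w - y)) - 1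
        - (‖w‖ ^ 2 - 1) / Complex.normSq (w - y)
        = (1 - ‖y‖ ^ 2) / Complex.normSq (w - y) := by
      field_simp
      rw [Complex.sq_norm, Complex.sq_norm]
      simp only [Complex.normSq_apply, Complex.sub_re, Complex.sub_im]
      ring
    rw [h2]
    have : 0 < 1 - ‖y‖ ^ 2 := by nlinarith [norm_nonneg y]
    positivity
  induction s using Multiset.induction_on with
  | empty => exact absurd rfl h0
  | cons y s ih =>
    have hy := base y (hs y (Multiset.mem_cons_self y s))
    by_cases hs0 : s = 0
    · subst hs0
      simpa using hy
    · have ih' := ih (fun x hx => hs x (Multiset.mem_cons_of_mem hx)) hs0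
      have hm : (0 : ℝ) < s.card := by
        exact_mod_cast Multiset.card_pos.2 hs0
      simp only [Multiset.map_cons, Multiset.sum_cons, Multiset.card_cons, Nat.cast_add,
        Nat.cast_one]
      generalize (s.map fun y => 1 / (w - y)).sum = S at *
      generalize 1 / (w - y) = Y at *
      generalize (s.card : ℝ) = m at *
      -- Convexity of the squared norm: the two sides differ by `|S - mY|²`.
      have titu : m * ‖Y + S‖ ^ 2 ≤ (m + 1) * (‖S‖ ^ 2 + m * ‖Y‖ ^ 2) := by
        rw [Complex.sq_norm, Complex.sq_norm, Complex.sq_norm]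
        simp only [Complex.normSq_apply, Complex.add_re, Complex.add_im]
        nlinarith [sq_nonneg (S.re - m * Y.re), sq_nonneg (S.im - m * Y.im)]
      have h1 := mul_le_mul_of_nonneg_left titu hq
      rw [mul_add w, Complex.add_re]
      have h2 : (m + 1) * ((‖w‖ ^ 2 - 1) * ‖S‖ ^ 2 + m * ((‖w‖ ^ 2 - 1) * ‖Y‖ ^ 2))
          < (m + 1) * (m * (2 * (w * S).re - m) + m * (2 * (w * Y).re - 1)) := by
        have := mul_lt_mul_of_pos_left hy hm
        exact mul_lt_mul_of_pos_left (by linarith) (by linarith)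
      refine lt_of_mul_lt_mul_left (a := m) ?_ hm.le
      nlinarith

theorem norm_mul_sum_recip_sub_card_lt {w : ℂ} (hw : 1 ≤ ‖w‖) (s : Multiset ℂ)
    (hs : ∀ y ∈ s, ‖y‖ < 1) (h0 : s ≠ 0) :
    ‖w * (s.map fun y => 1 / (w - y)).sum - s.card‖ < ‖(s.map fun y => 1 / (w - y)).sum‖ := by
  have h := sum_recip_quadratic_bound hw s hs h0
  generalize (s.map fun y => 1 / (w - y)).sum = S at *
  refine lt_of_pow_lt_pow_left₀ 2 (norm_nonneg _) ?_
  have : ‖w * S - s.card‖ ^ 2 = ‖w‖ ^ 2 * ‖S‖ ^ 2 - 2 * s.card * (w * S).re + (s.card : ℝ) ^ 2 := by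
    rw [← mul_pow, ← norm_mul]
    generalize w * S = T
    rw [Complex.sq_norm, Complex.sq_norm]
    simp only [Complex.normSq_apply, Complex.sub_re, Complex.sub_im, Complex.natCast_re,
      Complex.natCast_im]
    ring
  rw [this]
  linarith

theorem norm_multiset_sum_lt_card (s : Multiset ℂ) (hs : ∀ y ∈ s, ‖y‖ < 1) (h0 : s ≠ 0) :
    ‖s.sum‖ < s.card := by
  induction s using Multiset.induction_on with
  | empty => exact absurd rfl h0
  | cons y s ih =>
    have hy := hs y (Multiset.mem_cons_self y s)
    by_cases hs0 : s = 0
    · subst hs0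
      simpa using hy
    · have ih' := ih (fun x hx => hs x (Multiset.mem_cons_of_mem hx)) hs0
      rw [Multiset.sum_cons, Multiset.card_cons]
      push_cast
      linarith [norm_add_le y s.sum]

theorem multiset_prod_map_lt_prod_map {ι : Type*} (s : Multiset ι) (f g : ι → ℝ)
    (hf : ∀ i ∈ s, 0 ≤ f i) (hfg : ∀ i ∈ s, f i < g i) (h0 : s ≠ 0) :
    (s.map f).prod < (s.map g).prod := by
  induction s using Multiset.induction_on with
  | empty => exact absurd rfl h0
  | cons y s ih =>
    have hy := hfg y (Multiset.mem_cons_self y s)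
    have hy0 := hf y (Multiset.mem_cons_self y s)
    by_cases hs0 : s = 0
    · subst hs0
      simpa using hy
    · have ih' := ih (fun x hx => hf x (Multiset.mem_cons_of_mem hx))
        (fun x hx => hfg x (Multiset.mem_cons_of_mem hx)) hs0
      rw [Multiset.map_cons, Multiset.map_cons, Multiset.prod_cons, Multiset.prod_cons]
      have : 0 ≤ (s.map f).prod := by
        refine Multiset.prod_nonneg ?_
        intro a ha
        obtain ⟨i, hi, rfl⟩ := Multiset.mem_map.1 ha
        exact hf i (Multiset.mem_cons_of_mem hi)
      exact mul_lt_mul'' hy ih' hy0 this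

/-! ### Polar derivatives and Laguerre's theorem -/

/-- The polar derivative of a polynomial of formal degree `m` with respect to the point `b / a`
of the projective line, scaled by `a`. -/
noncomputable def polarDerivative (m : ℕ) (a b : ℂ) (H : ℂ[X]) : ℂ[X] :=
  C (a * m) * H + (C b - C a * X) * derivative H

theorem eval_polarDerivative (m : ℕ) (a b w : ℂ) (H : ℂ[X]) :
    (polarDerivative m a b H).eval w
      = a * m * H.eval w + (b - a * w) * (derivative H).eval w := by
  simp [polarDerivative]

theorem coeff_polarDerivative (m : ℕ) (a b : ℂ) (H : ℂ[X]) (j : ℕ) :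
    (polarDerivative m a b H).coeff j
      = a * (m - j) * H.coeff j + b * (j + 1) * H.coeff (j + 1) := by
  rw [polarDerivative, sub_mul, coeff_add, coeff_sub, coeff_C_mul, coeff_C_mul, mul_assoc (C a),
    coeff_C_mul, coeff_derivative]
  cases j with
  | zero => simp
  | succ j =>
    rw [coeff_X_mul, coeff_derivative]
    push_cast
    ring

/-- Laguerre's theorem for the unit disc. -/
theorem eval_polarDerivative_ne_zero {m : ℕ} (hm : m ≠ 0) {a b : ℂ} (hab : ‖a‖ ≤ ‖b‖) (hb : b ≠ 0)
    {H : ℂ[X]} (hdeg : H.natDegree = m) (hH : ∀ w : ℂ, 1 ≤ ‖w‖ → H.eval w ≠ 0)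
    {w : ℂ} (hw : 1 ≤ ‖w‖) : (polarDerivative m a b H).eval w ≠ 0 := by
  have hs : H.Splits := IsAlgClosed.splits H
  have hHw := hH w hw
  have hcard : H.roots.card = m := by rw [← hs.natDegree_eq_card_roots, hdeg]
  have hroots : ∀ y ∈ H.roots, ‖y‖ < 1 := by
    intro y hy
    by_contra! h
    exact hH y h (isRoot_of_mem_roots hy)
  have h0 : H.roots ≠ 0 := by
    intro h
    rw [h] at hcard
    exact hm hcard.symm
  have key := norm_mul_sum_recip_sub_card_lt hw H.roots hroots h0
  rw [← hs.eval_derivative_div_eval_of_ne_zero hHw, hcard] at key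
  rw [eval_polarDerivative]
  intro hQ
  -- A zero at `w` would force `a (wS - m) = b S` with `S = H'/H`, against `|wS - m| < |S|` and `|a|
  -- ≤ |b|`.
  have hQ' : a * (w * ((derivative H).eval w / H.eval w) - m)
      = b * ((derivative H).eval w / H.eval w) := by
    field_simp
    linear_combination -hQ
  have := congrArg norm hQ'
  rw [norm_mul, norm_mul] at this
  have h1 := mul_le_mul_of_nonneg_right hab
    (norm_nonneg (w * ((derivative H).eval w / H.eval w) - m))
  have h2 := mul_lt_mul_of_pos_left key (norm_pos_iff.2 hb)
  linarith

/-- The coefficient of degree `m` is the leading coefficient of `H` times `b(m+1) - a Σ y` over the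
zeros `y`, and `|Σ y| < m + 1`. Keeping the exact degree is what allows Laguerre's theorem to be
iterated. -/
theorem natDegree_polarDerivative {m : ℕ} {a b : ℂ} (hab : ‖a‖ ≤ ‖b‖) (hb : b ≠ 0)
    {H : ℂ[X]} (hdeg : H.natDegree = m + 1) (hH : ∀ w : ℂ, 1 ≤ ‖w‖ → H.eval w ≠ 0) :
    (polarDerivative (m + 1) a b H).natDegree = m := by
  have hs : H.Splits := IsAlgClosed.splits H
  have hcard : H.roots.card = m + 1 := by rw [← hs.natDegree_eq_card_roots, hdeg]
  have hroots : ∀ y ∈ H.roots, ‖y‖ < 1 := by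
    intro y hy
    by_contra! h
    exact hH y h (isRoot_of_mem_roots hy)
  have h0 : H.roots ≠ 0 := by
    intro h
    simp [h] at hcard
  have hsum := norm_multiset_sum_lt_card H.roots hroots h0
  have hlc : H.coeff (m + 1) ≠ 0 := by
    rw [← hdeg]
    refine leadingCoeff_ne_zero.2 ?_
    rintro rfl
    simp at hdeg
  refine natDegree_eq_of_le_of_coeff_ne_zero (natDegree_le_iff_coeff_eq_zero.2 ?_) ?_
  · intro j hj
    rw [coeff_polarDerivative, coeff_eq_zero_of_natDegree_lt (n := j + 1) (by omega)]
    rcases (Nat.succ_le_of_lt hj).eq_or_lt with h | h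
    · rw [← h]
      simp
    · rw [coeff_eq_zero_of_natDegree_lt (n := j) (by omega)]
      simp
  · have hnext := hs.nextCoeff_eq_neg_sum_roots_mul_leadingCoeff
    rw [nextCoeff_of_natDegree_pos (by omega), leadingCoeff, hdeg, Nat.add_sub_cancel] at hnext
    rw [coeff_polarDerivative, hnext]
    intro h
    have h1 : H.coeff (m + 1) * (b * (m + 1) - a * H.roots.sum) = 0 := by
      rw [← h]
      push_cast
      ring
    have h2 : b * ((m + 1 : ℕ) : ℂ) = a * H.roots.sum := by
      push_cast
      exact sub_eq_zero.1 ((mul_eq_zero.1 h1).resolve_left hlc)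
    have h3 := congrArg norm h2
    rw [norm_mul, norm_mul, Complex.norm_natCast, ← hcard] at h3
    have h4 := mul_le_mul_of_nonneg_right hab (norm_nonneg H.roots.sum)
    have h5 := mul_lt_mul_of_pos_left hsum (norm_pos_iff.2 hb)
    linarith

/-! ### The operators as composites of polar derivatives -/

/-- Homogeneous factors `p ζ - q` also cover a degenerate `U`, where `p = 0` stands for a root at
infinity. -/
theorem exists_quadratic_factorization (A B D : ℂ) : ∃ p₁ q₁ p₂ q₂ : ℂ,
    A = p₁ * p₂ ∧ B = -(p₁ * q₂ + p₂ * q₁) ∧ D = q₁ * q₂ := by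
  by_cases hA : A = 0
  · exact ⟨0, 1, -B, D, by simp [hA], by ring, by ring⟩
  · obtain ⟨s, hs⟩ := IsAlgClosed.exists_pow_nat_eq (discrim A B D) (n := 2) (by norm_num)
    refine ⟨A, (-B + s) / 2, 1, (-B - s) / (2 * A), by ring, by field_simp; ring, ?_⟩
    rw [discrim] at hs
    field_simp
    linear_combination hs

/-- For a linear factor `p ζ - q` of `U`, the data needed for the polar derivative. -/
theorem polar_data_of_factor {p q z : ℂ} {c : ℂ} (hc : c ≠ 0) (hz : 1 ≤ ‖z‖)
    (h : ∀ ζ : ℂ, p * ζ - q = 0 → ‖ζ‖ ≤ ‖ζ - c‖) :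
    ‖q‖ ≤ ‖z * (q - p * c)‖ ∧ z * (q - p * c) ≠ 0 := by
  have hle : ‖q‖ ≤ ‖q - p * c‖ := by
    by_cases hp : p = 0
    · simp [hp]
    · have h1 := h (q / p) (by field_simp; ring)
      have h2 : q - p * c = p * (q / p - c) := by field_simp
      have h3 : q = p * (q / p) := by field_simp
      rw [h2, norm_mul]
      conv_lhs => rw [h3, norm_mul]
      exact mul_le_mul_of_nonneg_left h1 (norm_nonneg p)
  refine ⟨?_, mul_ne_zero ?_ ?_⟩
  · rw [norm_mul]
    nlinarith [norm_nonneg (q - p * c)]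
  · rintro rfl
    norm_num at hz
  · intro h0
    -- If `q = p c`, then `c` is itself a zero of the factor, which the half-plane condition
    -- forbids.
    have h1 := h c (by linear_combination -h0)
    rw [sub_self, norm_zero, norm_le_zero_iff] at h1
    exact hc h1

theorem eval_rahmanOperator (n : ℕ) (l₀ l₁ l₂ z : ℂ) (P : ℂ[X]) :
    (rahmanOperator n l₀ l₁ l₂ P).eval z
      = l₀ * P.eval z + l₁ * (n / 2 * z) * (derivative P).eval z
        + l₂ * (n / 2 * z) ^ 2 * (1 / 2 * (derivative (derivative P)).eval z) := by
  simp [rahmanOperator]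

/-- Operators of the class `𝓑ₙ` preserve the property that all zeros lie in the open unit disc. -/
theorem eval_rahmanOperator_ne_zero {n : ℕ} (hn : n ≠ 0) {l₀ l₁ l₂ : ℂ}
    (hU : ∀ z : ℂ, l₀ + (n : ℂ) * l₁ * z + (n : ℂ) * ((n : ℂ) - 1) / 2 * l₂ * z ^ 2 = 0 →
      ‖z‖ ≤ ‖z - (n : ℂ) / 2‖)
    {H : ℂ[X]} (hdeg : H.natDegree = n) (hH : ∀ w : ℂ, 1 ≤ ‖w‖ → H.eval w ≠ 0)
    {z : ℂ} (hz : 1 ≤ ‖z‖) : (rahmanOperator n l₀ l₁ l₂ H).eval z ≠ 0 := by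
  have hc : (n : ℂ) / 2 ≠ 0 := by
    simpa using hn
  rw [eval_rahmanOperator]
  obtain ⟨m, rfl⟩ := Nat.exists_eq_succ_of_ne_zero hn
  rcases Nat.eq_zero_or_pos m with rfl | hm
  -- For `n = 1`, `U` is linear and `H'' = 0`, so one polar derivative suffices.
  · obtain ⟨hab, hb⟩ := polar_data_of_factor (p := -l₁) (q := l₀) hc hz fun ζ hζ => hU ζ (by
      push_cast
      linear_combination -hζ)
    have h := eval_polarDerivative_ne_zero hn hab hb hdeg hH hz
    rw [eval_polarDerivative] at h
    have h2 : derivative (derivative H) = 0 := by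
      rw [derivative_of_natDegree_zero]
      have := natDegree_derivative_le H
      omega
    intro h0
    apply h
    rw [h2] at h0
    rw [← h0, eval_zero]
    push_cast
    ring
  · obtain ⟨p₁, q₁, p₂, q₂, hA, hB, hD⟩ := exists_quadratic_factorization
      (((m.succ : ℕ) : ℂ) * (((m.succ : ℕ) : ℂ) - 1) / 2 * l₂) (((m.succ : ℕ) : ℂ) * l₁) l₀
    have hfac : ∀ ζ : ℂ, l₀ + ((m.succ : ℕ) : ℂ) * l₁ * ζ
        + ((m.succ : ℕ) : ℂ) * (((m.succ : ℕ) : ℂ) - 1) / 2 * l₂ * ζ ^ 2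
          = (p₁ * ζ - q₁) * (p₂ * ζ - q₂) := by
      intro ζ
      rw [hA, hB, hD]
      ring
    obtain ⟨hab₁, hb₁⟩ := polar_data_of_factor (p := p₁) (q := q₁) hc hz fun ζ hζ => hU ζ (by
      rw [hfac, hζ, zero_mul])
    obtain ⟨hab₂, hb₂⟩ := polar_data_of_factor (p := p₂) (q := q₂) hc hz fun ζ hζ => hU ζ (by
      rw [hfac, hζ, mul_zero])
    have h := eval_polarDerivative_ne_zero hm.ne' hab₁ hb₁
      (natDegree_polarDerivative hab₂ hb₂ hdeg hH)
      (fun w hw => eval_polarDerivative_ne_zero hn hab₂ hb₂ hdeg hH hw) hz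
    rw [eval_polarDerivative, eval_polarDerivative] at h
    have hd : (derivative (polarDerivative (m + 1) q₂ (z * (q₂ - p₂ * ((m.succ : ℕ) / 2))) H)).eval z
        = q₂ * m * (derivative H).eval z
          + (z * (q₂ - p₂ * ((m.succ : ℕ) / 2)) - q₂ * z) * (derivative (derivative H)).eval z := by
      simp [polarDerivative]
      ring
    rw [hd] at h
    intro h0
    apply h
    push_cast at hA hB h0 ⊢
    -- At `w = z` each `b - a w` equals `-p n z / 2`, which turns the coefficients of `U` into those
    -- of `B`.
    linear_combination ((m : ℂ) + 1) * m * h0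
      - ((m : ℂ) + 1) * m * H.eval z * hD
      - m * ((m : ℂ) + 1) / 2 * z * (derivative H).eval z * hB
      - ((m : ℂ) + 1) ^ 2 / 4 * z ^ 2 * (derivative (derivative H)).eval z * hA

/-! ### Growth outside a circle -/

/-- Maximum principle for `u^n P(1/u)` on the disc `|u| ≤ 1/k`. -/
theorem norm_eval_reflect_le {n : ℕ} {P : ℂ[X]} (hP : P.natDegree ≤ n) {k : ℝ} (hk : 0 < k)
    {u : ℂ} (hu : ‖u‖ ≤ 1 / k) : ‖(P.reflect n).eval u‖ ≤ maxModulus k P / k ^ n := by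
  have hk' : (1 / k) ≠ 0 := by positivity
  refine Complex.norm_le_of_forall_mem_frontier_norm_le (U := Metric.ball (0 : ℂ) (1 / k))
    Metric.isBounded_ball (P.reflect n).differentiable.diffContOnCl ?_ ?_
  · intro v hv
    rw [frontier_ball _ hk', mem_sphere_zero_iff_norm] at hv
    have hv0 : v ≠ 0 := by
      rintro rfl
      rw [norm_zero] at hv
      exact hk' hv.symm
    let _ : Invertible v⁻¹ := invertibleOfNonzero (inv_ne_zero hv0)
    have h := eval₂_reflect_mul_pow (RingHom.id ℂ) v⁻¹ n P hP
    simp only [invOf_eq_inv, inv_inv, eval₂_id] at h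
    have hvk : ‖v⁻¹‖ = k := by rw [norm_inv, hv, one_div, inv_inv]
    rw [le_div_iff₀ (by positivity)]
    calc ‖(P.reflect n).eval v‖ * k ^ n = ‖P.eval v⁻¹‖ := by
          rw [← h, norm_mul, norm_pow, hvk]
      _ ≤ maxModulus k P :=
          (isGreatest_maxModulus hk.le P).2 ⟨v⁻¹, by simpa using hvk, rfl⟩
  · rw [closure_ball _ hk']
    simpa using hu

theorem norm_coeff_le_maxModulus {n : ℕ} {P : ℂ[X]} (hP : P.natDegree ≤ n) {k : ℝ} (hk : 0 < k) :
    ‖P.coeff n‖ ≤ maxModulus k P / k ^ n := by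
  have h := norm_eval_reflect_le hP hk (u := 0) (by simpa using hk.le)
  rwa [← coeff_zero_eq_eval_zero, coeff_reflect, revAt_le (Nat.zero_le n), Nat.sub_zero] at h

theorem norm_eval_le_maxModulus {n : ℕ} {P : ℂ[X]} (hP : P.natDegree ≤ n) {k : ℝ} (hk : 0 < k)
    {w : ℂ} (hw : k ≤ ‖w‖) : ‖P.eval w‖ ≤ maxModulus k P / k ^ n * ‖w‖ ^ n := by
  have hw0 : w ≠ 0 := norm_pos_iff.1 (hk.trans_le hw)
  let _ : Invertible w := invertibleOfNonzero hw0
  have h := eval₂_reflect_mul_pow (RingHom.id ℂ) w n P hP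
  simp only [invOf_eq_inv, eval₂_id] at h
  rw [← h, norm_mul, norm_pow]
  refine mul_le_mul_of_nonneg_right (norm_eval_reflect_le hP hk ?_) (by positivity)
  rw [norm_inv, one_div]
  exact inv_anti₀ hk hw

/-! ### Dilations and location of zeros -/

theorem norm_mul_sub_lt_norm_mul_sub {R r : ℝ} (hr : 0 < r) (hRr : r < R) {z y : ℂ}
    (hz : 1 ≤ ‖z‖) (hy : ‖y‖ < r) : ‖r * z - y‖ < ‖R * z - y‖ := by
  refine lt_of_pow_lt_pow_left₀ 2 (norm_nonneg _) ?_
  have hexp : ∀ t : ℝ, ‖t * z - y‖ ^ 2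
      = t ^ 2 * ‖z‖ ^ 2 - 2 * t * (z * (starRingEnd ℂ) y).re + ‖y‖ ^ 2 := by
    intro t
    rw [Complex.sq_norm, Complex.sq_norm, Complex.sq_norm]
    simp [Complex.normSq_apply]
    ring
  have hre : (z * (starRingEnd ℂ) y).re ≤ ‖z‖ * ‖y‖ := by
    refine (Complex.re_le_norm _).trans_eq ?_
    rw [norm_mul, RCLike.norm_conj]
  rw [hexp, hexp]
  have h1 : ‖z‖ * ‖y‖ < ‖z‖ * r := mul_lt_mul_of_pos_left hy (by linarith)
  have h2 : ‖z‖ * r ≤ ‖z‖ ^ 2 * r :=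
    mul_le_mul_of_nonneg_right (le_self_pow₀ hz two_ne_zero) hr.le
  have h3 : 0 < (R - r) * ((R + r) * ‖z‖ ^ 2 - 2 * (z * (starRingEnd ℂ) y).re) := by
    refine mul_pos (by linarith) ?_
    nlinarith [sq_nonneg ‖z‖]
  linarith

theorem norm_eval_lt_norm_eval {G : ℂ[X]} (hdeg : G.natDegree ≠ 0) {R r : ℝ} (hr : 0 < r)
    (hRr : r < R) (hG : ∀ w : ℂ, r ≤ ‖w‖ → G.eval w ≠ 0) {z : ℂ} (hz : 1 ≤ ‖z‖) :
    ‖G.eval (r * z)‖ < ‖G.eval (R * z)‖ := by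
  have hs : G.Splits := IsAlgClosed.splits G
  have h0 : G.roots ≠ 0 := by
    intro h
    apply hdeg
    rw [hs.natDegree_eq_card_roots, h, Multiset.card_zero]
  have hnorm : ∀ w : ℂ, ‖G.eval w‖ = ‖G.leadingCoeff‖ * (G.roots.map fun y => ‖w - y‖).prod := by
    intro w
    rw [hs.eval_eq_prod_roots, norm_mul]
    congr 1
    rw [← coe_nnnorm]
    induction G.roots using Multiset.induction_on with
    | empty => simp
    | cons y s ih => simpa using Or.inl ih
  rw [hnorm, hnorm]
  refine mul_lt_mul_of_pos_left ?_ (norm_pos_iff.2 (leadingCoeff_ne_zero.2 ?_))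
  · refine multiset_prod_map_lt_prod_map _ _ _ (fun _ _ => norm_nonneg _) ?_ h0
    intro y hy
    refine norm_mul_sub_lt_norm_mul_sub hr hRr hz ?_
    by_contra! h
    exact hG y h (isRoot_of_mem_roots hy)
  · rintro rfl
    simp at hdeg

theorem eval_dilate (t : ℝ) (P : ℂ[X]) (z : ℂ) : (dilate t P).eval z = P.eval (t * z) := by
  simp [dilate]

theorem coeff_dilate (t : ℝ) (P : ℂ[X]) (j : ℕ) :
    (dilate t P).coeff j = P.coeff j * (t : ℂ) ^ j := by
  rw [dilate, comp_C_mul_X_coeff]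

theorem natDegree_dilate_le (t : ℝ) (P : ℂ[X]) : (dilate t P).natDegree ≤ P.natDegree := by
  refine natDegree_le_iff_coeff_eq_zero.2 fun j hj => ?_
  rw [coeff_dilate, coeff_eq_zero_of_natDegree_lt hj, zero_mul]

theorem dilate_sub (t : ℝ) (P Q : ℂ[X]) : dilate t (P - Q) = dilate t P - dilate t Q := by
  simp [dilate]

theorem dilate_C_mul_X_pow (t : ℝ) (a : ℂ) (n : ℕ) :
    dilate t (C a * X ^ n) = C (a * (t : ℂ) ^ n) * X ^ n := by
  simp [dilate, mul_pow]
  ring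

theorem rahmanOperator_sub (n : ℕ) (l₀ l₁ l₂ : ℂ) (P Q : ℂ[X]) :
    rahmanOperator n l₀ l₁ l₂ (P - Q)
      = rahmanOperator n l₀ l₁ l₂ P - rahmanOperator n l₀ l₁ l₂ Q := by
  simp only [rahmanOperator, derivative_sub]
  ring

theorem rahmanOperator_C_mul (n : ℕ) (l₀ l₁ l₂ a : ℂ) (P : ℂ[X]) :
    rahmanOperator n l₀ l₁ l₂ (C a * P) = C a * rahmanOperator n l₀ l₁ l₂ P := by
  simp only [rahmanOperator, derivative_C_mul]
  ring

theorem pow_sub_mul_pow_ne_zero {n : ℕ} (hn : n ≠ 0) {α : ℂ} (hα : ‖α‖ ≤ 1) {R r : ℝ} (hr : 0 < r)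
    (hRr : r < R) : (R : ℂ) ^ n - α * (r : ℂ) ^ n ≠ 0 := by
  intro h
  have h1 := congrArg norm (sub_eq_zero.1 h)
  rw [norm_mul, norm_pow, norm_pow, Complex.norm_of_nonneg hr.le,
    Complex.norm_of_nonneg (hr.trans hRr).le] at h1
  have h2 : r ^ n < R ^ n := pow_lt_pow_left₀ hRr hr.le hn
  have h3 : ‖α‖ * r ^ n ≤ r ^ n := mul_le_of_le_one_left (by positivity) hα
  linarith

/-- If all zeros of `G`, of degree `n ≥ 1`, lie in the disc `|w| < r`, then
`G(R z) - α G(r z)` has degree `n` and all its zeros lie in the open unit disc. -/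
theorem dilate_sub_dilate_properties {n : ℕ} (hn : n ≠ 0) {α : ℂ} (hα : ‖α‖ ≤ 1) {R r : ℝ}
    (hr : 0 < r) (hRr : r < R) {G : ℂ[X]} (hdeg : G.natDegree = n)
    (hG : ∀ w : ℂ, r ≤ ‖w‖ → G.eval w ≠ 0) :
    (dilate R G - C α * dilate r G).natDegree = n ∧
      ∀ w : ℂ, 1 ≤ ‖w‖ → (dilate R G - C α * dilate r G).eval w ≠ 0 := by
  constructor
  · refine natDegree_eq_of_le_of_coeff_ne_zero ?_ ?_
    · refine (natDegree_sub_le_of_le ((natDegree_dilate_le _ _).trans hdeg.le) ?_).trans_eq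
        (max_self n)
      exact (natDegree_C_mul_le _ _).trans ((natDegree_dilate_le _ _).trans hdeg.le)
    · rw [coeff_sub, coeff_C_mul, coeff_dilate, coeff_dilate]
      have hlc : G.coeff n ≠ 0 := by
        rw [← hdeg]
        refine leadingCoeff_ne_zero.2 ?_
        rintro rfl
        exact hn (by simpa using hdeg.symm)
      intro h
      refine mul_ne_zero hlc (pow_sub_mul_pow_ne_zero hn hα hr hRr) ?_
      rw [← h]
      ring
  · intro w hw h
    have hlt := norm_eval_lt_norm_eval (hdeg.trans_ne hn) hr hRr hG hw
    rw [eval_sub, eval_mul, eval_C, eval_dilate, eval_dilate, sub_eq_zero] at h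
    rw [h, norm_mul] at hlt
    exact absurd hlt (not_lt.2 (mul_le_of_le_one_left (norm_nonneg _) hα))

theorem natDegree_sub_C_mul_X_pow_and_eval_ne_zero {n : ℕ} {P : ℂ[X]} (hP : P.natDegree ≤ n) {k : ℝ}
    (hk : 0 < k) {c : ℂ} (hc : maxModulus k P / k ^ n < ‖c‖) :
    (P - C c * X ^ n).natDegree = n ∧ ∀ w : ℂ, k ≤ ‖w‖ → (P - C c * X ^ n).eval w ≠ 0 := by
  constructor
  · refine natDegree_eq_of_le_of_coeff_ne_zero
      ((natDegree_sub_le_of_le hP (natDegree_C_mul_X_pow_le c n)).trans_eq (max_self n)) ?_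
    rw [coeff_sub, coeff_C_mul_X_pow, if_pos rfl]
    intro h
    have h1 := norm_coeff_le_maxModulus hP hk
    rw [sub_eq_zero.1 h] at h1
    linarith
  · intro w hw h
    have h1 := norm_eval_le_maxModulus hP hk hw
    rw [eval_sub, eval_mul, eval_C, eval_pow, eval_X, sub_eq_zero] at h
    rw [h, norm_mul, norm_pow] at h1
    have : 0 < ‖w‖ ^ n := pow_pos (hk.trans_le hw) n
    exact absurd (lt_of_mul_lt_mul_right (h1.trans_lt (mul_lt_mul_of_pos_right hc this)) this.le)
      (lt_irrefl _)

/-! ### The extremal monomials and the inequality -/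

theorem maxModulus_C_mul_X_pow {k : ℝ} (hk : 0 ≤ k) (a : ℂ) (n : ℕ) :
    maxModulus k (C a * X ^ n) = ‖a‖ * k ^ n := by
  obtain ⟨w, hw, h⟩ := (isGreatest_maxModulus hk (C a * X ^ n)).1
  rw [← h]
  rw [mem_sphere_zero_iff_norm] at hw
  simp [hw]

theorem norm_rahmanOperator_dilate_sub_monomial (n : ℕ) (l₀ l₁ l₂ α : ℂ) (R r : ℝ) {k : ℝ}
    (hk : 0 < k) (z a : ℂ) :
    ‖(rahmanOperator n l₀ l₁ l₂ (dilate R (C a * X ^ n))).eval z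
        - α * (rahmanOperator n l₀ l₁ l₂ (dilate r (C a * X ^ n))).eval z‖
      = 1 / k ^ n * ‖(R : ℂ) ^ n - α * (r : ℂ) ^ n‖
        * ‖(rahmanOperator n l₀ l₁ l₂ (X ^ n)).eval z‖ * maxModulus k (C a * X ^ n) := by
  rw [dilate_C_mul_X_pow, dilate_C_mul_X_pow, rahmanOperator_C_mul, rahmanOperator_C_mul, eval_mul,
    eval_mul, eval_C, eval_C, maxModulus_C_mul_X_pow hk.le]
  generalize (rahmanOperator n l₀ l₁ l₂ (X ^ n)).eval z = b
  have h : a * (R : ℂ) ^ n * b - α * (a * (r : ℂ) ^ n * b)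
      = a * ((R : ℂ) ^ n - α * (r : ℂ) ^ n) * b := by ring
  rw [h, norm_mul, norm_mul]
  field_simp

theorem norm_rahmanOperator_dilate_sub_le {n : ℕ} {l₀ l₁ l₂ : ℂ}
    (hU : ∀ z : ℂ, l₀ + (n : ℂ) * l₁ * z + (n : ℂ) * ((n : ℂ) - 1) / 2 * l₂ * z ^ 2 = 0 →
      ‖z‖ ≤ ‖z - (n : ℂ) / 2‖)
    {α : ℂ} (hα : ‖α‖ ≤ 1) {R r k : ℝ} (hRr : r < R) (hrk : k ≤ r) (hk : 0 < k)
    {z : ℂ} (hz : 1 ≤ ‖z‖) {P : ℂ[X]} (hP : P.natDegree ≤ n) :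
    ‖(rahmanOperator n l₀ l₁ l₂ (dilate R P)).eval z
        - α * (rahmanOperator n l₀ l₁ l₂ (dilate r P)).eval z‖
      ≤ 1 / k ^ n * ‖(R : ℂ) ^ n - α * (r : ℂ) ^ n‖
        * ‖(rahmanOperator n l₀ l₁ l₂ (X ^ n)).eval z‖ * maxModulus k P := by
  have hr : 0 < r := hk.trans_le hrk
  have hmono : ∀ (t : ℝ) (c : ℂ), (rahmanOperator n l₀ l₁ l₂ (dilate t (C c * X ^ n))).eval z
      = c * (t : ℂ) ^ n * (rahmanOperator n l₀ l₁ l₂ (X ^ n)).eval z := by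
    intro t c
    rw [dilate_C_mul_X_pow, rahmanOperator_C_mul, eval_mul, eval_C]
  -- For `n = 0` both `B[1]` and `1 - α` may vanish, so division by `D b` is unavailable; but `P` is
  -- then itself an extremal monomial.
  by_cases hn : n = 0
  · subst hn
    obtain ⟨c, rfl⟩ := natDegree_eq_zero.1 (Nat.le_zero.1 hP)
    have hc : (C c : ℂ[X]) = C c * X ^ 0 := by simp
    rw [hc]
    exact (norm_rahmanOperator_dilate_sub_monomial 0 l₀ l₁ l₂ α R r hk z c).le
  · have hB0 : (rahmanOperator n l₀ l₁ l₂ (X ^ n)).eval z ≠ 0 :=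
      eval_rahmanOperator_ne_zero hn hU (natDegree_X_pow n) (fun w hw h => by
        rw [eval_pow, eval_X] at h
        rw [eq_zero_of_pow_eq_zero h, norm_zero] at hw
        norm_num at hw) hz
    have hRα := pow_sub_mul_pow_ne_zero hn hα hr hRr
    by_contra! hlt
    set L := (rahmanOperator n l₀ l₁ l₂ (dilate R P)).eval z
        - α * (rahmanOperator n l₀ l₁ l₂ (dilate r P)).eval z with hL
    set b := (rahmanOperator n l₀ l₁ l₂ (X ^ n)).eval z with hb
    set D := (R : ℂ) ^ n - α * (r : ℂ) ^ n with hD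
    have hc : maxModulus k P / k ^ n < ‖L / (D * b)‖ := by
      rw [norm_div, norm_mul,
        lt_div_iff₀ (mul_pos (norm_pos_iff.2 hRα) (norm_pos_iff.2 hB0))]
      refine lt_of_eq_of_lt ?_ hlt
      ring
    obtain ⟨hdeg, hG⟩ := natDegree_sub_C_mul_X_pow_and_eval_ne_zero hP hk hc
    obtain ⟨hdegH, hH⟩ := dilate_sub_dilate_properties hn hα hr hRr hdeg
      fun w hw => hG w (hrk.trans hw)
    refine eval_rahmanOperator_ne_zero hn hU hdegH hH hz ?_
    rw [rahmanOperator_sub, rahmanOperator_C_mul, dilate_sub, dilate_sub, rahmanOperator_sub,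
      rahmanOperator_sub, eval_sub, eval_mul, eval_C, eval_sub, eval_sub, hmono, hmono]
    have : L / (D * b) * (D * b) = L := div_mul_cancel₀ _ (mul_ne_zero hRα hB0)
    rw [hL] at this
    linear_combination -this


theorem corollary2p5 (n : ℕ) (B : ℂ[X] → ℂ[X]) (hB : B ∈ rahmanClass n)
    (α : ℂ) (hα : ‖α‖ ≤ 1) (R r k : ℝ) (hRr : r < R) (hrk : k ≤ r) (hk : 0 < k)
    (z : ℂ) (hz : 1 ≤ ‖z‖) :
    -- the inequality
    (∀ P : ℂ[X], P.natDegree ≤ n →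
      ‖(B (dilate R P)).eval z - α * (B (dilate r P)).eval z‖
        ≤ 1 / k ^ n * ‖(R : ℂ) ^ n - α * (r : ℂ) ^ n‖ * ‖(B (X ^ n)).eval z‖
          * maxModulus k P) ∧
    -- equality for `P(z) = a z ^ n`, `a ≠ 0`
    (∀ a : ℂ, a ≠ 0 →
      ‖(B (dilate R (C a * X ^ n))).eval z - α * (B (dilate r (C a * X ^ n))).eval z‖
        = 1 / k ^ n * ‖(R : ℂ) ^ n - α * (r : ℂ) ^ n‖ * ‖(B (X ^ n)).eval z‖
          * maxModulus k (C a * X ^ n)) ∧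
    -- the factor in front of the maximum cannot be replaced by a smaller one
    (∀ K : ℝ,
      (∀ P : ℂ[X], P.natDegree ≤ n →
        ‖(B (dilate R P)).eval z - α * (B (dilate r P)).eval z‖ ≤ K * maxModulus k P) →
      1 / k ^ n * ‖(R : ℂ) ^ n - α * (r : ℂ) ^ n‖ * ‖(B (X ^ n)).eval z‖ ≤ K) := by
  obtain ⟨l₀, l₁, l₂, hU, rfl⟩ := hB
  have heq : ∀ a : ℂ, ‖(rahmanOperator n l₀ l₁ l₂ (dilate R (C a * X ^ n))).eval z
        - α * (rahmanOperator n l₀ l₁ l₂ (dilate r (C a * X ^ n))).eval z‖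
      = 1 / k ^ n * ‖(R : ℂ) ^ n - α * (r : ℂ) ^ n‖
        * ‖(rahmanOperator n l₀ l₁ l₂ (X ^ n)).eval z‖ * maxModulus k (C a * X ^ n) :=
    norm_rahmanOperator_dilate_sub_monomial n l₀ l₁ l₂ α R r hk z
  refine ⟨fun P hP => norm_rahmanOperator_dilate_sub_le hU hα hRr hrk hk hz hP,
    fun a _ => heq a, fun K hK => ?_⟩
  have h := hK (C 1 * X ^ n) (natDegree_C_mul_X_pow_le 1 n)
  rw [heq 1] at h
  refine le_of_mul_le_mul_right h ?_
  rw [maxModulus_C_mul_X_pow hk.le]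
  simp [hk]
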